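/- A poset is called $(2+2)$-free if it has no induced subposet isomorphic to the disjoint union of two $2$-element chains. For $n,k\ge 0$ let $p_n$ be the number of $(2+2)$-free posets on $n$ elements up to isomorphism, let $p_{n,k}$ be the number of those with exactly $k$ minimal elements, and put $$P(t)=\sum_{n\ge 0}p_n t^n\in\mathbb Z[[t]],\qquad P(t,z)=\sum_{n,k\ge 0}p_{n,k}\,t^n z^k\in\mathbb Z[[t,z]].$$ An ascent sequence of length $n$ is a sequence $(x_1,\dots,x_n)$ of natural numbers with $x_1=0$ and $0\le x_i\le 1+\mathrm{asc}(x_1,\dots,x_{i-1})$ for $2\le i\le n$, where $\mathrm{asc}(x_1,\dots,x_j)=|\{1\le m<j: x_m<x_{m+1}\}|$; the empty sequence is the ascent sequence of length $0$. Then: 1. For all $n,k\ge 0$, $p_n$ is the number of ascent sequences of length $n$, and $p_{n,k}$ is the number of ascent sequences of length $n$ with exactly $k$ zeros. 2. For every $n\ge 0$, the map $a_1\dots a_n\mapsto 0\,(a_1+1)\dots(a_n+1)$ is a bijection from the ascent sequences of length $n$ to the ascent sequences of length $n+1$ with exactly one zero. 3. As formal power series, $$P(t)=\frac1t\,\frac{\partial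 P(t,z)}{\partial z}\Big|_{z=0}=\sum_{n\ge 0}\ \prod_{i=1}^n\bigl(1-(1-t)^i\bigr).$$ -/

import Mathlib

open scoped PowerSeries.WithPiTopology

namespace TwoPlusTwo

/-- A poset is (2+2)-free if no induced subposet is isomorphic to the disjoint union of two
2-element chains. (The order on the type `Fin 2 ⊕ Fin 2` is the disjoint one.) -/
def IsFree (α : Type) [PartialOrder α] : Prop :=
  IsEmpty ((Fin 2 ⊕ Fin 2) ↪o α)

/-- The number of minimal elements of a poset. -/
noncomputable def numMin (α : Type) [PartialOrder α] : ℕ :=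
  Nat.card {x : α // IsMin x}

/-- Isomorphism of posets, restricted to the partial orders on `Fin n` with property `S`. -/
def isoSetoid (n : ℕ) (S : PartialOrder (Fin n) → Prop) :
    Setoid {P : PartialOrder (Fin n) // S P} where
  r P Q := Nonempty (@OrderIso (Fin n) (Fin n) P.1.toLE Q.1.toLE)
  iseqv :=
    { refl := fun P => ⟨@OrderIso.refl (Fin n) P.1.toLE⟩
      symm := fun {P Q} ⟨e⟩ => ⟨@OrderIso.symm (Fin n) (Fin n) P.1.toLE Q.1.toLE e⟩
      trans := fun {P Q R} ⟨e⟩ ⟨f⟩ =>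
        ⟨@OrderIso.trans (Fin n) (Fin n) (Fin n) P.1.toLE Q.1.toLE R.1.toLE e f⟩ }

/-- `p n`: the number of unlabeled (2+2)-free posets on `n` elements. -/
noncomputable def p (n : ℕ) : ℕ :=
  Nat.card (Quotient (isoSetoid n fun P => @IsFree (Fin n) P))

/-- `pMin n k`: the number of unlabeled (2+2)-free posets on `n` elements
with exactly `k` minimal elements. -/
noncomputable def pMin (n k : ℕ) : ℕ :=
  Nat.card (Quotient (isoSetoid n fun P => @IsFree (Fin n) P ∧ @numMin (Fin n) P = k))

/-- The number of ascents of a sequence of natural numbers. -/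
def asc (l : List ℕ) : ℕ :=
  ((Finset.range (l.length - 1)).filter fun j => l.getD j 0 < l.getD (j + 1) 0).card

/-- Ascent sequences (the empty sequence is one): the first entry is `0`, and each later entry
is at most one more than the number of ascents of the sequence that precedes it. -/
def IsAscentSeq (l : List ℕ) : Prop :=
  (∀ h : 0 < l.length, l[0] = 0) ∧
    ∀ (i : ℕ) (h : i < l.length), 1 ≤ i → l[i] ≤ 1 + asc (l.take i)

/-- The set of ascent sequences of length `n`. -/
def ascentSeqs (n : ℕ) : Set (List ℕ) :=
  {l | IsAscentSeq l ∧ l.length = n}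

/-- The set of ascent sequences of length `n` with exactly `k` zeros. -/
def ascentSeqsZeros (n k : ℕ) : Set (List ℕ) :=
  {l | IsAscentSeq l ∧ l.length = n ∧ l.count 0 = k}

/-- The map sending `a` to `0a⁺`. -/
def zeroShift (a : List ℕ) : List ℕ :=
  0 :: a.map (· + 1)

/-- The generating function `P(t) = ∑ₙ pₙ tⁿ`. -/
noncomputable def genP : PowerSeries ℤ :=
  PowerSeries.mk fun n => (p n : ℤ)

/-- The generating function `P(t, z) = ∑ pₙₖ tⁿ zᵏ`, as an element of `ℤ⟦t⟧⟦z⟧`: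
the outer variable is `z`, the inner variable is `t`. -/
noncomputable def genPz : PowerSeries (PowerSeries ℤ) :=
  PowerSeries.mk fun k => PowerSeries.mk fun n => (pMin n k : ℤ)

end TwoPlusTwo

/-! A (2+2)-free poset is an interval order, and its minimal representation by intervals with
endpoints in `{0, …, d - 1}` is unique, so a (2+2)-free poset on `n` elements is the same as a
multiset of `n` pairs `a ≤ b < d` in which every `a` and every `b` below `d` occurs: an upper
triangular matrix without zero rows or columns whose entries sum to `n`. The minimal elements are
counted by the first row of this matrix.

An ascent sequence is a recipe for building such a matrix one entry at a time. A new term names the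
row of the new entry, which becomes the first nonzero entry of the last column; this requires a new
row and a new column exactly when the sequence ascends, so the dimension is one more than the number
of ascents.

To count the matrices, apply inclusion-exclusion to the rows and then multiply over the columns. The
contributions of the sets of `a` rows satisfy a recursion in the dimension `d`; summed over `d`, it
becomes the recursion `F (a + 1) = ((1 - t)⁻ᵃ⁻¹ - 1) * (F a - F (a + 1))`, whose solution is
`F a = ∏ᵢ (1 - (1 - t)^i)`. -/

namespace TwoPlusTwo

/-- A Fishburn matrix of dimension `d`: an upper triangular matrix of natural numbers without zero
rows or columns, encoded as the multiset of its positions, each repeated according to its entry. -/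
structure IsFishburn (d : ℕ) (M : Multiset (ℕ × ℕ)) : Prop where
  upper : ∀ a b, (a, b) ∈ M → a ≤ b ∧ b < d
  row : ∀ a < d, ∃ b, (a, b) ∈ M
  col : ∀ b < d, ∃ a, (a, b) ∈ M

theorem IsFishburn.dim_le {d e : ℕ} {M : Multiset (ℕ × ℕ)} (hd : IsFishburn d M)
    (he : IsFishburn e M) : d ≤ e := by
  by_contra! h
  obtain ⟨b, hb⟩ := hd.row e h
  have := he.upper e b hb
  omega

theorem IsFishburn.dim_unique {d e : ℕ} {M : Multiset (ℕ × ℕ)} (hd : IsFishburn d M)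
    (he : IsFishburn e M) : d = e :=
  le_antisymm (hd.dim_le he) (he.dim_le hd)

theorem IsFishburn.dim_le_card {d : ℕ} {M : Multiset (ℕ × ℕ)} (h : IsFishburn d M) :
    d ≤ M.card := by
  have hsub : Finset.range d ⊆ (M.map Prod.fst).toFinset := fun a ha => by
    obtain ⟨b, hb⟩ := h.row a (Finset.mem_range.1 ha)
    exact Multiset.mem_toFinset.2 (Multiset.mem_map_of_mem Prod.fst hb)
  simpa using (Finset.card_le_card hsub).trans (Multiset.toFinset_card_le _)

/-- The Fishburn matrices whose entries sum to `n`. -/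
def fishburnMatrices (n : ℕ) : Set (Multiset (ℕ × ℕ)) :=
  {M | M.card = n ∧ ∃ d, IsFishburn d M}

/-- The intervals `F x` are the minimal representation of `r` as an interval order: `r x y` means
that the interval of `x` lies to the left of that of `y`, and each of the points `0, …, d - 1` is
both a left and a right endpoint. -/
structure IsIntervalRep {α : Type*} [Fintype α] (r : α → α → Prop) (d : ℕ) (F : α → ℕ × ℕ) :
    Prop where
  rel : ∀ x y, r x y ↔ (F x).2 < (F y).1
  isFishburn : IsFishburn d (Finset.univ.val.map F)

section IntervalRep

variable {α β : Type*} [Fintype α] [Fintype β] {r : α → α → Prop} {d e : ℕ} {F G : α → ℕ × ℕ}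

theorem isFishburn_map_univ_iff :
    IsFishburn d (Finset.univ.val.map F) ↔ (∀ x, (F x).1 ≤ (F x).2 ∧ (F x).2 < d) ∧
      (∀ a < d, ∃ x, (F x).1 = a) ∧ ∀ b < d, ∃ x, (F x).2 = b := by
  have hmem : ∀ a b, (a, b) ∈ Finset.univ.val.map F ↔ ∃ x, F x = (a, b) := by simp
  constructor
  · rintro ⟨hupper, hrow, hcol⟩
    refine ⟨fun x => hupper _ _ ((hmem _ _).2 ⟨x, rfl⟩), fun a ha => ?_, fun b hb => ?_⟩
    · obtain ⟨b, hb⟩ := hrow a ha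
      exact ((hmem a b).1 hb).imp fun x hx => congrArg Prod.fst hx
    · obtain ⟨a, ha⟩ := hcol b hb
      exact ((hmem a b).1 ha).imp fun x hx => congrArg Prod.snd hx
  · rintro ⟨hupper, hrow, hcol⟩
    refine ⟨fun a b hab => ?_, fun a ha => ?_, fun b hb => ?_⟩
    · obtain ⟨x, hx⟩ := (hmem a b).1 hab
      simpa only [hx] using hupper x
    · obtain ⟨x, rfl⟩ := hrow a ha
      exact ⟨(F x).2, (hmem _ _).2 ⟨x, rfl⟩⟩
    · obtain ⟨x, rfl⟩ := hcol b hb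
      exact ⟨(F x).1, (hmem _ _).2 ⟨x, rfl⟩⟩

theorem IsIntervalRep.le_and_lt (h : IsIntervalRep r d F) (x : α) :
    (F x).1 ≤ (F x).2 ∧ (F x).2 < d :=
  (isFishburn_map_univ_iff.1 h.isFishburn).1 x

theorem IsIntervalRep.exists_left_eq (h : IsIntervalRep r d F) {a : ℕ} (ha : a < d) :
    ∃ x, (F x).1 = a :=
  (isFishburn_map_univ_iff.1 h.isFishburn).2.1 a ha

theorem IsIntervalRep.exists_right_eq (h : IsIntervalRep r d F) {b : ℕ} (hb : b < d) :
    ∃ x, (F x).2 = b :=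
  (isFishburn_map_univ_iff.1 h.isFishburn).2.2 b hb

theorem IsIntervalRep.left_le_iff (h : IsIntervalRep r d F) (x y : α) :
    (F x).1 ≤ (F y).1 ↔ ∀ u, r u x → r u y := by
  simp only [h.rel]
  refine ⟨fun hxy u hu => hu.trans_le hxy, fun H => ?_⟩
  by_contra! hlt
  obtain ⟨u, hu⟩ := h.exists_right_eq ((h.le_and_lt y).1.trans_lt (h.le_and_lt y).2)
  have := H u (by omega)
  omega

/-- The left endpoint of `x` is the rank of `{u | r u x}` among these sets, so it is determined
by `r`. -/
theorem IsIntervalRep.left_le (hF : IsIntervalRep r d F) (hG : IsIntervalRep r e G) (x : α) :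
    (F x).1 ≤ (G x).1 := by
  induction hc : (F x).1 generalizing x with
  | zero => exact Nat.zero_le _
  | succ c ih =>
    have hx := hF.le_and_lt x
    obtain ⟨y, hy⟩ := hF.exists_left_eq (a := c) (by omega)
    have hyx : ¬ (F x).1 ≤ (F y).1 := by omega
    rw [hF.left_le_iff, ← hG.left_le_iff] at hyx
    have := ih y hy
    omega

theorem IsIntervalRep.left_unique (hF : IsIntervalRep r d F) (hG : IsIntervalRep r e G) (x : α) :
    (F x).1 = (G x).1 :=
  le_antisymm (hF.left_le hG x) (hG.left_le hF x)

theorem IsIntervalRep.right_le (hF : IsIntervalRep r d F) (hG : IsIntervalRep r e G) (x : α) :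
    (F x).2 ≤ (G x).2 := by
  by_contra! hlt
  obtain ⟨y, hy⟩ := hF.exists_left_eq (hF.le_and_lt x).2
  have hxy : r x y := (hG.rel x y).2 (by rw [← hF.left_unique hG, hy]; exact hlt)
  rw [hF.rel] at hxy
  omega

theorem IsIntervalRep.unique (hF : IsIntervalRep r d F) (hG : IsIntervalRep r e G) : F = G :=
  funext fun x => Prod.ext (hF.left_unique hG x) (le_antisymm (hF.right_le hG x) (hG.right_le hF x))

theorem IsIntervalRep.comp {s : β → β → Prop} (h : IsIntervalRep r d F) (f : s ≃r r) :
    IsIntervalRep s d (F ∘ f) where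
  rel x y := f.map_rel_iff.symm.trans (h.rel _ _)
  isFishburn := by
    rw [← Multiset.map_map, show ⇑f = f.toEquiv from rfl, Multiset.map_univ_val_equiv]
    exact h.isFishburn

theorem map_univ_eq_iff {γ : Type*} {F : α → γ} {G : β → γ} :
    Finset.univ.val.map F = Finset.univ.val.map G ↔ ∃ f : α ≃ β, F = G ∘ f := by
  classical
  constructor
  · intro h
    have hcard : ∀ c, Fintype.card {x // F x = c} = Fintype.card {y // G y = c} := fun c => by
      have hcount := congrArg (Multiset.countP (· = c)) h
      rw [Multiset.countP_map, Multiset.countP_map] at hcount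
      rw [Fintype.card_subtype, Fintype.card_subtype]
      exact hcount
    let f := Equiv.ofFiberEquiv fun c => Fintype.equivOfCardEq (hcard c)
    exact ⟨f, funext fun x => (Equiv.ofFiberEquiv_map _ x).symm⟩
  · rintro ⟨f, rfl⟩
    rw [← Multiset.map_map, Multiset.map_univ_val_equiv]

end IntervalRep

section Poset

theorem IsIntervalRep.map_eq_iff_nonempty_orderIso {α β : Type*} [Fintype α] [Fintype β]
    [PartialOrder α] [PartialOrder β] {d e : ℕ} {F : α → ℕ × ℕ} {G : β → ℕ × ℕ}
    (hF : IsIntervalRep (α := α) (· < ·) d F) (hG : IsIntervalRep (α := β) (· < ·) e G) :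
    Finset.univ.val.map F = Finset.univ.val.map G ↔ Nonempty (α ≃o β) := by
  rw [map_univ_eq_iff]
  constructor
  · rintro ⟨f, rfl⟩
    refine ⟨⟨f, fun {x y} => ?_⟩⟩
    rw [le_iff_lt_or_eq, le_iff_lt_or_eq, f.injective.eq_iff, hF.rel x y, hG.rel (f x) (f y)]
    rfl
  · rintro ⟨f⟩
    exact ⟨f.toEquiv, hF.unique (hG.comp f.toRelIsoLT)⟩

variable {α : Type} [PartialOrder α]

theorem IsIntervalRep.isFree [Fintype α] {d : ℕ} {F : α → ℕ × ℕ}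
    (h : IsIntervalRep (α := α) (· < ·) d F) : IsFree α := by
  refine ⟨fun f => ?_⟩
  have h₁ : f (Sum.inl 0) < f (Sum.inl 1) := by simp
  have h₂ : f (Sum.inr 0) < f (Sum.inr 1) := by simp
  have h₃ : ¬ f (Sum.inl 0) < f (Sum.inr 1) := by simp
  have h₄ : ¬ f (Sum.inr 0) < f (Sum.inl 1) := by simp
  rw [h.rel] at h₁ h₂ h₃ h₄
  omega

theorem IsIntervalRep.isMin_iff {α : Type*} [PartialOrder α] [Fintype α] {d : ℕ} {F : α → ℕ × ℕ}
    (h : IsIntervalRep (α := α) (· < ·) d F) (x : α) : IsMin x ↔ (F x).1 = 0 := by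
  simp only [isMin_iff_forall_not_lt, h.rel]
  refine ⟨fun hx => ?_, fun hx y => by omega⟩
  obtain ⟨y, hy⟩ := h.exists_right_eq (Nat.zero_lt_of_lt (h.le_and_lt x).2)
  have := hx y
  omega

theorem IsIntervalRep.numMin_eq [Fintype α] {d : ℕ} {F : α → ℕ × ℕ}
    (h : IsIntervalRep (α := α) (· < ·) d F) :
    numMin α = (Finset.univ.val.map F).countP fun q => q.1 = 0 := by
  classical
  rw [numMin, Multiset.countP_map, Nat.card_congr (Equiv.subtypeEquivRight h.isMin_iff),
    Nat.card_eq_fintype_card, Fintype.card_subtype]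
  rfl

theorem IsFree.lt_or_lt (hα : IsFree α) {u v x y : α} (hux : u < x) (hvy : v < y) :
    u < y ∨ v < x := by
  by_contra! H
  obtain ⟨huy', hvx'⟩ := H
  have huy : ¬ u ≤ y := fun h => h.eq_or_lt.elim (fun h => hvx' ((h ▸ hvy).trans hux)) huy'
  have hvx : ¬ v ≤ x := fun h => h.eq_or_lt.elim (fun h => huy' ((h ▸ hux).trans hvy)) hvx'
  have huv : ¬ u ≤ v := fun h => huy (h.trans hvy.le)
  have hvu : ¬ v ≤ u := fun h => hvx (h.trans hux.le)
  have hxv : ¬ x ≤ v := fun h => huv (hux.le.trans h)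
  have hxy : ¬ x ≤ y := fun h => huy (hux.le.trans h)
  have hyu : ¬ y ≤ u := fun h => hvu (hvy.le.trans h)
  have hyx : ¬ y ≤ x := fun h => hvx (hvy.le.trans h)
  refine hα.false (OrderEmbedding.ofMapLEIff (Sum.elim ![u, x] ![v, y]) ?_)
  rintro (a | a) (b | b) <;> fin_cases a <;> fin_cases b <;>
    simp [hux.le, hvy.le, hux.not_ge, hvy.not_ge, *]

theorem IsFree.isChain_range_Iio (hα : IsFree α) :
    IsChain (· ≤ ·) (Set.range (Set.Iio : α → Set α)) := by
  rintro _ ⟨x, rfl⟩ _ ⟨y, rfl⟩ -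
  by_contra! H
  obtain ⟨u, hux, huy⟩ := Set.not_subset.1 H.1
  obtain ⟨v, hvy, hvx⟩ := Set.not_subset.1 H.2
  exact (hα.lt_or_lt hux hvy).elim huy hvx

theorem exists_orderEmbedding_fin_range_eq {β : Type*} [PartialOrder β] {C : Set β}
    (hfin : C.Finite) (hC : IsChain (· ≤ ·) C) :
    ∃ (d : ℕ) (E : Fin d ↪o β), Set.range E = C := by
  classical
  let := hC.linearOrder
  let := hfin.fintype
  let e : Fin (Fintype.card C) ≃o C := Fintype.orderIsoFinOfCardEq C rfl
  exact ⟨Fintype.card C, e.toOrderEmbedding.trans (OrderEmbedding.subtype C),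
    (e.surjective.range_comp Subtype.val).trans Subtype.range_coe⟩

/-- `x` is sent to the interval from the index of `Set.Iio x` to the last index whose set
misses `x`. -/
theorem IsFree.exists_isIntervalRep [Fintype α] (hα : IsFree α) :
    ∃ (d : ℕ) (F : α → ℕ × ℕ), IsIntervalRep (α := α) (· < ·) d F := by
  obtain ⟨d, E, hE⟩ :=
    exists_orderEmbedding_fin_range_eq (Set.finite_range _) hα.isChain_range_Iio
  choose f hf using fun x => hE.symm.subset (Set.mem_range_self x)
  have hnot : ∀ x, x ∉ E (f x) := fun x => by simp [hf]
  have hgreatest : ∀ x, ∃ c, IsGreatest {c | x ∉ E c} c := fun x =>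
    (Set.toFinite _).isCompact.exists_isGreatest ⟨f x, hnot x⟩
  choose g hg using hgreatest
  have mem_iff : ∀ x c, x ∈ E c ↔ g x < c := fun x c => by
    refine ⟨fun hx => ?_, fun hc => ?_⟩
    · by_contra! hle
      exact (hg x).1 (E.monotone hle hx)
    · by_contra hx
      exact ((hg x).2 hx).not_gt hc
  have hle : ∀ x, f x ≤ g x := fun x => (hg x).2 (hnot x)
  refine ⟨d, fun x => (f x, g x), fun x y => ?_, isFishburn_map_univ_iff.2
    ⟨fun x => ⟨hle x, (g x).2⟩, fun a ha => ?_, fun b hb => ?_⟩⟩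
  · rw [← Set.mem_Iio, ← hf, mem_iff, Fin.lt_def]
  · obtain ⟨x, hx⟩ := hE.subset (Set.mem_range_self ⟨a, ha⟩)
    exact ⟨x, congrArg Fin.val (E.injective ((hf x).trans hx))⟩
  · obtain ⟨u, hu, hu'⟩ : ∃ u, u ∉ E ⟨b, hb⟩ ∧ ∀ c > ⟨b, hb⟩, u ∈ E c := by
      rcases Nat.lt_or_ge (b + 1) d with hlt | hlast
      · have hss : E ⟨b, hb⟩ < E ⟨b + 1, hlt⟩ := E.strictMono (Fin.mk_lt_mk.2 b.lt_succ_self)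
        obtain ⟨u, hu, hu'⟩ := Set.exists_of_ssubset hss
        exact ⟨u, hu', fun c hc => E.monotone (Fin.mk_le_of_le_val hc) hu⟩
      · obtain ⟨y, hy⟩ := hE.subset (Set.mem_range_self ⟨b, hb⟩)
        refine ⟨y, by simp [← hy], fun c hc => ?_⟩
        have : b < c := hc
        omega
    exact ⟨u, congrArg Fin.val <| (hg u).unique
      ⟨hu, fun c hc => not_lt.1 fun hlt => hc (hu' c hlt)⟩⟩

end Poset

section Count

variable {ι β : Type*}

/-- The interval order of a family of intervals, given by their pairs of endpoints. -/
abbrev intervalOrder [Preorder β] (F : ι → β × β) (hF : ∀ x, (F x).1 ≤ (F x).2) :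
    PartialOrder ι :=
  have : IsStrictOrder ι fun x y => (F x).2 < (F y).1 :=
    { irrefl := fun x => (hF x).not_gt
      trans := fun _ y _ hxy hyz => hxy.trans ((hF y).trans_lt hyz) }
  partialOrderOfSO fun x y => (F x).2 < (F y).1

theorem exists_map_univ_eq {n : ℕ} (M : Multiset β) (hM : M.card = n) :
    ∃ F : Fin n → β, Finset.univ.val.map F = M := by
  subst hM
  induction M using Quotient.inductionOn with
  | h l => exact ⟨l.get, (Fin.univ_val_map _).trans (congrArg _ (List.ofFn_get l))⟩

theorem IsFishburn.exists_isIntervalRep {d : ℕ} {M : Multiset (ℕ × ℕ)} (h : IsFishburn d M)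
    {n : ℕ} (hM : M.card = n) : ∃ (P : PartialOrder (Fin n)) (F : Fin n → ℕ × ℕ),
      IsIntervalRep P.lt d F ∧ Finset.univ.val.map F = M := by
  obtain ⟨F, hF⟩ := exists_map_univ_eq M hM
  rw [← hF] at h
  exact ⟨intervalOrder F fun x => ((isFishburn_map_univ_iff.1 h).1 x).1, F,
    ⟨fun _ _ => Iff.rfl, h⟩, hF⟩

theorem card_quotient_isoSetoid {n : ℕ} {S : PartialOrder (Fin n) → Prop}
    {T : Multiset (ℕ × ℕ) → Prop} (hfree : ∀ P, S P → @IsFree (Fin n) P)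
    (hST : ∀ (P : PartialOrder (Fin n)) (d : ℕ) (F : Fin n → ℕ × ℕ), IsIntervalRep P.lt d F →
      (S P ↔ T (Finset.univ.val.map F))) :
    Nat.card (Quotient (isoSetoid n S)) = {M ∈ fishburnMatrices n | T M}.ncard := by
  choose d F hF using fun P : {P // S P} =>
    @IsFree.exists_isIntervalRep (Fin n) P.1 _ (hfree P.1 P.2)
  have hker : isoSetoid n S = Setoid.ker fun P => Finset.univ.val.map (F P) :=
    Setoid.ext fun P Q =>
      (@IsIntervalRep.map_eq_iff_nonempty_orderIso _ _ _ _ P.1 Q.1 _ _ _ _ (hF P) (hF Q)).symm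
  have hrange : Set.range (fun P => Finset.univ.val.map (F P)) =
      {M ∈ fishburnMatrices n | T M} := by
    ext M
    constructor
    · rintro ⟨P, rfl⟩
      exact ⟨⟨by simp, d P, (hF P).isFishburn⟩, (hST P.1 _ _ (hF P)).1 P.2⟩
    · rintro ⟨⟨hM, e, he⟩, hT⟩
      obtain ⟨P, G, hG, rfl⟩ := he.exists_isIntervalRep hM
      have hP : S P := (hST P e G hG).2 hT
      exact ⟨⟨P, hP⟩, congrArg (Multiset.map · _) ((hF ⟨P, hP⟩).unique hG)⟩
  rw [hker, Nat.card_congr (Setoid.quotientKerEquivRange _), Nat.card_coe_set_eq, hrange]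

theorem p_eq_ncard_fishburnMatrices (n : ℕ) : p n = (fishburnMatrices n).ncard := by
  have h := card_quotient_isoSetoid (n := n) (T := fun _ => True) (fun _ hP => hP)
    fun P d F hF => iff_of_true (@IsIntervalRep.isFree (Fin n) P _ d F hF) trivial
  simp only [p, h, and_true, Set.ofPred_mem_eq]

theorem pMin_eq_ncard_fishburnMatrices (n k : ℕ) :
    pMin n k = {M ∈ fishburnMatrices n | (M.countP fun q => q.1 = 0) = k}.ncard :=
  card_quotient_isoSetoid (fun _ hP => hP.1) fun P d F hF => by
    rw [← @IsIntervalRep.numMin_eq (Fin n) P _ d F hF]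
    exact and_iff_right (@IsIntervalRep.isFree (Fin n) P _ d F hF)

end Count

/-- A nonempty Fishburn matrix of dimension `d` and index `i`: the first nonzero entry of the last
column is in row `i`. -/
structure IsIndexed (d i : ℕ) (M : Multiset (ℕ × ℕ)) : Prop extends IsFishburn d M where
  mem_last : (i, d - 1) ∈ M
  le_of_mem_last : ∀ a, (a, d - 1) ∈ M → i ≤ a

theorem IsIndexed.index_unique {d i j : ℕ} {M : Multiset (ℕ × ℕ)} (hi : IsIndexed d i M)
    (hj : IsIndexed d j M) : i = j :=
  le_antisymm (hi.le_of_mem_last j hj.mem_last) (hj.le_of_mem_last i hi.mem_last)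

theorem IsFishburn.exists_isIndexed {d : ℕ} {M : Multiset (ℕ × ℕ)} (h : IsFishburn d M)
    (hd : 0 < d) : ∃ i, IsIndexed d i M := by
  classical
  have hcol := h.col (d - 1) (by omega)
  exact ⟨Nat.find hcol, h, Nat.find_spec hcol, fun a ha => Nat.find_min' hcol ha⟩

theorem isFishburn_zero : IsFishburn 0 0 := ⟨by simp, by simp, by simp⟩

theorem IsFishburn.eq_zero {M : Multiset (ℕ × ℕ)} (h : IsFishburn 0 M) : M = 0 :=
  Multiset.eq_zero_of_forall_notMem fun ⟨a, b⟩ hab => (h.upper a b hab).2.not_ge b.zero_le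

theorem IsFishburn.mem_last {d : ℕ} {M : Multiset (ℕ × ℕ)} (h : IsFishburn d M) (hd : 0 < d) :
    (d - 1, d - 1) ∈ M := by
  obtain ⟨b, hb⟩ := h.row (d - 1) (by omega)
  obtain rfl : b = d - 1 := by have := h.upper _ _ hb; omega
  exact hb

/-- The new place of an entry of a matrix of dimension `d` when an empty row and an empty column
are inserted before row and column `l`, and the part of the last column above row `l` is then
moved into the new column `l`. -/
def insertPos (d l : ℕ) (q : ℕ × ℕ) : ℕ × ℕ :=
  if q.1 < l then (q.1, if q.2 < l then q.2 else if q.2 + 1 < d then q.2 + 1 else l)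
  else (q.1 + 1, q.2 + 1)

/-- The inverse of `insertPos d l`. -/
def deletePos (d l : ℕ) (q : ℕ × ℕ) : ℕ × ℕ :=
  if q.1 < l then (q.1, if q.2 < l then q.2 else if q.2 = l then d - 1 else q.2 - 1)
  else (q.1 - 1, q.2 - 1)

theorem deletePos_insertPos {d l a b : ℕ} (hab : a ≤ b) (hb : b < d) (hl : l ≤ d) :
    deletePos d l (insertPos d l (a, b)) = (a, b) := by
  grind [insertPos, deletePos]

theorem insertPos_deletePos {d l a b : ℕ} (hab : a ≤ b) (hb : b ≤ d) (hl : l ≤ d) (ha : a ≠ l)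
    (hbd : b = d → l ≤ a) : insertPos d l (deletePos d l (a, b)) = (a, b) := by
  grind [insertPos, deletePos]

theorem insertPos_le_and_lt {d l a b : ℕ} (hab : a ≤ b) (hb : b < d) :
    (insertPos d l (a, b)).1 ≤ (insertPos d l (a, b)).2 ∧ (insertPos d l (a, b)).2 < d + 1 := by
  grind [insertPos]

theorem le_insertPos_fst_of_snd_eq {d l a b : ℕ} (hb : b < d)
    (h : (insertPos d l (a, b)).2 = d) : l ≤ (insertPos d l (a, b)).1 := by
  grind [insertPos]

theorem insertPos_fst_ne (d l : ℕ) (q : ℕ × ℕ) : (insertPos d l q).1 ≠ l := by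
  grind [insertPos]

/-- An entry of the last column in row `l` would not be the first one of that column. -/
def NeedsNewRow (d : ℕ) (M : Multiset (ℕ × ℕ)) (l : ℕ) : Prop :=
  d = 0 ∨ ∃ a < l, (a, d - 1) ∈ M

open Classical in
/-- Adds one to the sum of the entries of a Fishburn matrix of dimension `d`, in such a way that
the result has index `l`. -/
noncomputable def addEntry (d : ℕ) (M : Multiset (ℕ × ℕ)) (l : ℕ) : Multiset (ℕ × ℕ) :=
  if NeedsNewRow d M l then (l, d) ::ₘ M.map (insertPos d l) else (l, d - 1) ::ₘ M

section AddEntry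

variable {d l : ℕ} {M : Multiset (ℕ × ℕ)}

theorem IsIndexed.needsNewRow_iff {i : ℕ} (h : IsIndexed d i M) :
    NeedsNewRow d M l ↔ i < l := by
  constructor
  · rintro (rfl | ⟨a, hal, ha⟩)
    · exact absurd (h.upper _ _ h.mem_last).2 (Nat.not_lt_zero _)
    · exact (h.le_of_mem_last a ha).trans_lt hal
  · exact fun hil => Or.inr ⟨i, hil, h.mem_last⟩

theorem card_addEntry : (addEntry d M l).card = M.card + 1 := by
  rw [addEntry]
  split_ifs <;> simp

theorem IsFishburn.lt_of_not_needsNewRow (h : IsFishburn d M) (hl : l ≤ d)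
    (hrow : ¬ NeedsNewRow d M l) : l < d := by
  have hd : 0 < d := Nat.pos_of_ne_zero fun hd => hrow (Or.inl hd)
  have hld : ¬ d - 1 < l := fun hlt => hrow (Or.inr ⟨d - 1, hlt, h.mem_last hd⟩)
  omega

theorem IsFishburn.isIndexed_cons (h : IsFishburn d M) (hl : l < d)
    (hrow : ¬ NeedsNewRow d M l) : IsIndexed d l ((l, d - 1) ::ₘ M) where
  upper a b hab := by
    rcases Multiset.mem_cons.1 hab with heq | hab
    · cases heq
      omega
    · exact h.upper a b hab
  row a ha := (h.row a ha).imp fun _ hb => Multiset.mem_cons_of_mem hb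
  col b hb := (h.col b hb).imp fun _ ha => Multiset.mem_cons_of_mem ha
  mem_last := Multiset.mem_cons_self _ _
  le_of_mem_last a ha := by
    rcases Multiset.mem_cons.1 ha with heq | ha
    · exact (congrArg Prod.fst heq).ge
    · exact not_lt.1 fun hal => hrow (Or.inr ⟨a, hal, ha⟩)

theorem IsFishburn.isIndexed_cons_map_insertPos (h : IsFishburn d M) (hl : l ≤ d)
    (hrow : NeedsNewRow d M l) :
    IsIndexed (d + 1) l ((l, d) ::ₘ M.map (insertPos d l)) := by
  have hmem : ∀ {q}, q ∈ (l, d) ::ₘ M.map (insertPos d l) ↔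
      q = (l, d) ∨ ∃ a b, (a, b) ∈ M ∧ insertPos d l (a, b) = q := by
    simp
  refine ⟨⟨fun a b hab => ?_, fun a ha => ?_, fun b hb => ?_⟩, Multiset.mem_cons_self _ _,
    fun a ha => ?_⟩
  · rcases hmem.1 hab with heq | ⟨a', b', hab', heq⟩
    · cases heq
      omega
    · simpa only [heq] using
        insertPos_le_and_lt (l := l) (h.upper a' b' hab').1 (h.upper a' b' hab').2
  · rcases lt_trichotomy a l with hal | rfl | hla
    · obtain ⟨b, hb⟩ := h.row a (by omega)
      exact ⟨_, hmem.2 (Or.inr ⟨a, b, hb, by rw [insertPos, if_pos hal]⟩)⟩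
    · exact ⟨d, Multiset.mem_cons_self _ _⟩
    · obtain ⟨b, hb⟩ := h.row (a - 1) (by omega)
      exact ⟨b + 1, hmem.2 (Or.inr ⟨a - 1, b, hb, by grind [insertPos]⟩)⟩
  · rcases lt_trichotomy b l with hbl | rfl | hlb
    · obtain ⟨a, ha⟩ := h.col b (by omega)
      have := h.upper a b ha
      exact ⟨a, hmem.2 (Or.inr ⟨a, b, ha, by grind [insertPos]⟩)⟩
    · obtain rfl | ⟨a, hab, ha⟩ := hrow
      · exact ⟨b, by grind⟩
      · by_cases hbd : b = d
        · exact ⟨b, hmem.2 (Or.inl (by rw [hbd]))⟩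
        · exact ⟨a, hmem.2 (Or.inr ⟨a, d - 1, ha, by grind [insertPos]⟩)⟩
    · obtain ⟨a, ha⟩ := h.col (b - 1) (by omega)
      by_cases hbd : b = d
      · exact ⟨l, hmem.2 (Or.inl (by rw [hbd]))⟩
      · exact ⟨_, hmem.2 (Or.inr ⟨a, b - 1, ha, Prod.ext rfl (by grind [insertPos])⟩)⟩
  · rcases hmem.1 ha with heq | ⟨a', b', hab', heq⟩
    · exact (congrArg Prod.fst heq).ge
    · simpa only [heq] using
        le_insertPos_fst_of_snd_eq (h.upper a' b' hab').2 (congrArg Prod.snd heq)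

open Classical in
theorem IsFishburn.isIndexed_addEntry (h : IsFishburn d M) (hl : l ≤ d) :
    IsIndexed (if NeedsNewRow d M l then d + 1 else d) l (addEntry d M l) := by
  rw [addEntry]
  split_ifs with hrow
  · exact h.isIndexed_cons_map_insertPos hl hrow
  · exact h.isIndexed_cons (h.lt_of_not_needsNewRow hl hrow) hrow

theorem IsFishburn.map_deletePos_map_insertPos (h : IsFishburn d M) (hl : l ≤ d) :
    (M.map (insertPos d l)).map (deletePos d l) = M := by
  rw [Multiset.map_map]
  refine (Multiset.map_congr rfl fun ⟨a, b⟩ hab => ?_).trans M.map_id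
  exact deletePos_insertPos (h.upper a b hab).1 (h.upper a b hab).2 hl

theorem map_insertPos_ne {M' : Multiset (ℕ × ℕ)} {d' : ℕ} (h : IsFishburn d' M') (hl : l < d') :
    M.map (insertPos d l) ≠ M' := by
  rintro rfl
  obtain ⟨b, hb⟩ := h.row l hl
  obtain ⟨q, -, hq⟩ := Multiset.mem_map.1 hb
  exact insertPos_fst_ne d l q (congrArg Prod.fst hq)

theorem IsFishburn.addEntry_injective {d' l' : ℕ} {M' : Multiset (ℕ × ℕ)} (h : IsFishburn d M)
    (h' : IsFishburn d' M') (hl : l ≤ d) (hl' : l' ≤ d')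
    (heq : addEntry d M l = addEntry d' M' l') : M = M' ∧ l = l' := by
  have hidx := h.isIndexed_addEntry hl
  have hidx' := h'.isIndexed_addEntry hl'
  rw [← heq] at hidx'
  have hdim := hidx.dim_unique hidx'.toIsFishburn
  rw [← hdim] at hidx'
  obtain rfl := hidx.index_unique hidx'
  refine ⟨?_, rfl⟩
  rw [addEntry, addEntry] at heq
  split_ifs at heq hdim with hrow hrow' hrow'
  · obtain rfl : d = d' := by omega
    rw [← h.map_deletePos_map_insertPos hl, ← h'.map_deletePos_map_insertPos hl,
      (Multiset.cons_inj_right _).1 heq]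
  · subst hdim
    exact absurd ((Multiset.cons_inj_right _).1 heq)
      (map_insertPos_ne h' (h'.lt_of_not_needsNewRow hl' hrow'))
  · subst hdim
    exact absurd ((Multiset.cons_inj_right _).1 heq).symm
      (map_insertPos_ne h (h.lt_of_not_needsNewRow hl hrow))
  · subst hdim
    exact (Multiset.cons_inj_right _).1 heq

theorem IsIndexed.dim_pos {i : ℕ} (h : IsIndexed d i M) : 0 < d :=
  Nat.zero_lt_of_lt (h.upper _ _ h.mem_last).2

theorem IsIndexed.isFishburn_of_cons (h : IsIndexed d l ((l, d - 1) ::ₘ M))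
    (hrow : ∃ b, (l, b) ∈ M) : IsFishburn d M := by
  have hupper := fun a b hab => h.upper a b (Multiset.mem_cons_of_mem hab)
  have hrow' : ∀ a < d, ∃ b, (a, b) ∈ M := fun a ha => by
    obtain ⟨b, hb⟩ := h.row a ha
    rcases Multiset.mem_cons.1 hb with heq | hb
    · obtain rfl : a = l := congrArg Prod.fst heq
      exact hrow
    · exact ⟨b, hb⟩
  refine ⟨hupper, hrow', fun b hb => ?_⟩
  obtain ⟨a, ha⟩ := h.col b hb
  rcases Multiset.mem_cons.1 ha with heq | ha
  · obtain ⟨c, hc⟩ := hrow' b hb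
    have := hupper b c hc
    obtain rfl : c = b := by have := congrArg Prod.snd heq; simp only at this; omega
    exact ⟨c, hc⟩
  · exact ⟨a, ha⟩

theorem IsIndexed.map_insertPos_map_deletePos (h : IsIndexed (d + 1) l ((l, d) ::ₘ M))
    (hrow : ∀ b, (l, b) ∉ M) : (M.map (deletePos d l)).map (insertPos d l) = M := by
  rw [Multiset.map_map]
  refine (Multiset.map_congr rfl fun ⟨a, b⟩ hab => ?_).trans M.map_id
  have hab' := h.upper a b (Multiset.mem_cons_of_mem hab)
  refine insertPos_deletePos hab'.1 (by omega) (h.upper _ _ h.mem_last).1 ?_ ?_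
  · rintro rfl
    exact hrow b hab
  · rintro rfl
    exact h.le_of_mem_last a (Multiset.mem_cons_of_mem hab)

theorem IsIndexed.mem_of_mem_cons (h : IsIndexed (d + 1) l ((l, d) ::ₘ M))
    (hrow : ∀ b, (l, b) ∉ M) {a b : ℕ} (hab : (a, b) ∈ (l, d) ::ₘ M) (hne : a ≠ l ∨ b ≠ d) :
    (a, b) ∈ M ∧ a ≠ l ∧ a ≤ b ∧ b ≤ d ∧ (b = d → l ≤ a) := by
  have habM : (a, b) ∈ M := by
    refine (Multiset.mem_cons.1 hab).resolve_left fun heq => ?_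
    cases heq
    simp at hne
  have := h.upper a b hab
  refine ⟨habM, fun hal => hrow b (hal ▸ habM), by omega, by omega, ?_⟩
  rintro rfl
  exact h.le_of_mem_last a hab

theorem IsIndexed.isFishburn_map_deletePos (h : IsIndexed (d + 1) l ((l, d) ::ₘ M))
    (hrow : ∀ b, (l, b) ∉ M) : IsFishburn d (M.map (deletePos d l)) := by
  have hl : l ≤ d := (h.upper _ _ h.mem_last).1
  have hmem : ∀ {a b a' b'}, (a, b) ∈ M → deletePos d l (a, b) = (a', b') →
      (a', b') ∈ M.map (deletePos d l) := fun hab heq => heq ▸ Multiset.mem_map_of_mem _ hab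
  refine ⟨fun a' b' hab' => ?_, fun a ha => ?_, fun b hb => ?_⟩
  · obtain ⟨⟨a, b⟩, hab, heq⟩ := Multiset.mem_map.1 hab'
    have hal : a ≠ l := fun hal => hrow b (hal ▸ hab)
    obtain ⟨-, -, hle, hbd, hlast⟩ :=
      h.mem_of_mem_cons hrow (Multiset.mem_cons_of_mem hab) (Or.inl hal)
    grind [deletePos]
  · by_cases hal : a < l
    · obtain ⟨b, hb⟩ := h.row a (by omega)
      obtain ⟨hbM, -⟩ := h.mem_of_mem_cons hrow hb (Or.inl hal.ne)
      exact ⟨_, hmem hbM (if_pos hal)⟩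
    · obtain ⟨b, hb⟩ := h.row (a + 1) (by omega)
      obtain ⟨hbM, -⟩ := h.mem_of_mem_cons hrow hb (Or.inl (by omega))
      exact ⟨b - 1, hmem hbM (if_neg (by omega))⟩
  · by_cases hbl : b < l
    · obtain ⟨a, ha⟩ := h.col b (by omega)
      obtain ⟨haM, -, hle, -⟩ := h.mem_of_mem_cons hrow ha (Or.inr (by omega))
      exact ⟨a, hmem haM (by grind [deletePos])⟩
    · by_cases hbd : b + 1 < d
      · obtain ⟨a, ha⟩ := h.col (b + 1) (by omega)
        obtain ⟨haM, -⟩ := h.mem_of_mem_cons hrow ha (Or.inr (by omega))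
        exact ⟨_, hmem haM (Prod.ext rfl (by grind [deletePos]))⟩
      · obtain ⟨haM, -⟩ := h.mem_of_mem_cons hrow (h.toIsFishburn.mem_last d.succ_pos)
          (Or.inl (by omega))
        exact ⟨d - 1, hmem haM (by grind [deletePos])⟩

theorem IsIndexed.needsNewRow_map_deletePos (h : IsIndexed (d + 1) l ((l, d) ::ₘ M))
    (hrow : ∀ b, (l, b) ∉ M) : NeedsNewRow d (M.map (deletePos d l)) l := by
  refine or_iff_not_imp_left.2 fun hd => ?_
  have hl : l ≤ d := (h.upper _ _ h.mem_last).1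
  obtain ⟨a, ha⟩ := h.col (if l < d then l else d - 1) (by split_ifs <;> omega)
  obtain ⟨haM, hne, hle, -⟩ := h.mem_of_mem_cons hrow ha (Or.inr (by split_ifs <;> omega))
  have hal : a < l := by split_ifs at hle <;> omega
  refine ⟨a, hal, Multiset.mem_map.2 ⟨_, haM, ?_⟩⟩
  grind [deletePos]

theorem IsIndexed.exists_addEntry_eq {e : ℕ} {B : Multiset (ℕ × ℕ)} (h : IsIndexed e l B) :
    ∃ d M, IsFishburn d M ∧ l ≤ d ∧ addEntry d M l = B := by
  obtain ⟨R, rfl⟩ := Multiset.exists_cons_of_mem h.mem_last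
  have hle := h.upper _ _ h.mem_last
  by_cases hrow : ∃ b, (l, b) ∈ R
  · refine ⟨e, R, h.isFishburn_of_cons hrow, by omega, if_neg ?_⟩
    rintro (rfl | ⟨a, hal, ha⟩)
    · exact h.dim_pos.ne rfl
    · exact (h.le_of_mem_last a (Multiset.mem_cons_of_mem ha)).not_gt hal
  · push Not at hrow
    obtain ⟨d, rfl⟩ := Nat.exists_eq_succ_of_ne_zero h.dim_pos.ne'
    refine ⟨d, R.map (deletePos d l), h.isFishburn_map_deletePos hrow, hle.1, ?_⟩
    rw [addEntry, if_pos (h.needsNewRow_map_deletePos hrow),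
      h.map_insertPos_map_deletePos hrow]
    rfl

theorem insertPos_fst_eq_zero_iff (hl : 0 < l) (q : ℕ × ℕ) :
    (insertPos d l q).1 = 0 ↔ q.1 = 0 := by
  grind [insertPos]

theorem IsFishburn.countP_addEntry (h : IsFishburn d M) :
    ((addEntry d M l).countP fun q => q.1 = 0) =
      (M.countP fun q => q.1 = 0) + if l = 0 then 1 else 0 := by
  rw [addEntry]
  split_ifs with hrow hl hl
  · obtain rfl : d = 0 := hrow.resolve_right fun ⟨a, ha, _⟩ =>
      Nat.not_lt_zero a (ha.trans_eq hl)
    rw [h.eq_zero, Multiset.map_zero, Multiset.countP_cons, if_pos hl]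
  · rw [Multiset.countP_cons, Multiset.countP_map, if_neg hl, Multiset.countP_eq_card_filter]
    simp only [insertPos_fst_eq_zero_iff (Nat.pos_of_ne_zero hl)]
  · rw [Multiset.countP_cons, if_pos hl]
  · rw [Multiset.countP_cons, if_neg hl]

end AddEntry

section AscentSequences

/-- The largest number that may follow an ascent sequence; it is also the dimension of the
Fishburn matrix of that sequence. -/
def ascBound (l : List ℕ) : ℕ :=
  if l = [] then 0 else asc l + 1

variable {l : List ℕ} {x n k : ℕ}

theorem asc_concat_concat (m : List ℕ) (y x : ℕ) :
    asc (m ++ [y] ++ [x]) = asc (m ++ [y]) + if y < x then 1 else 0 := by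
  have hlen₂ : (m ++ [y] ++ [x]).length - 1 = m.length + 1 := by simp
  have hlen₁ : (m ++ [y]).length - 1 = m.length := by simp
  have hinit : (Finset.range m.length).filter (fun j => (m ++ [y] ++ [x]).getD j 0 <
      (m ++ [y] ++ [x]).getD (j + 1) 0) = (Finset.range m.length).filter (fun j =>
      (m ++ [y]).getD j 0 < (m ++ [y]).getD (j + 1) 0) := by
    refine Finset.filter_congr fun j hj => ?_
    rw [Finset.mem_range] at hj
    rw [List.getD_append _ _ _ j (by rw [List.length_append]; omega),
      List.getD_append _ _ _ (j + 1) (by simpa using hj)]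
  have hy : (m ++ [y] ++ [x]).getD m.length 0 = y := by simp
  have hx : (m ++ [y] ++ [x]).getD (m.length + 1) 0 = x := by simp
  rw [asc, asc, hlen₂, hlen₁, Finset.range_add_one, Finset.filter_insert, hinit, hy, hx]
  split_ifs
  · rw [Finset.card_insert_of_notMem (by simp)]
  · rfl

theorem ascBound_concat (l : List ℕ) (x : ℕ) : ascBound (l ++ [x]) =
    if l = [] ∨ l.getLastD 0 < x then ascBound l + 1 else ascBound l := by
  rcases l.eq_nil_or_concat' with rfl | ⟨m, y, rfl⟩
  · rfl
  · simp only [ascBound, asc_concat_concat, List.append_eq_nil_iff, List.cons_ne_self, and_false,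
      if_false, false_or, List.getLastD_concat]
    split_ifs <;> rfl

theorem isAscentSeq_nil : IsAscentSeq [] := by
  simp [IsAscentSeq]

theorem isAscentSeq_concat : IsAscentSeq (l ++ [x]) ↔ IsAscentSeq l ∧ x ≤ ascBound l := by
  rcases eq_or_ne l [] with rfl | hl
  · simp [IsAscentSeq, ascBound]
  have hpos : 0 < l.length := List.length_pos_of_ne_nil hl
  have hpos' : 0 < (l ++ [x]).length := by simp
  rw [ascBound, if_neg hl, add_comm]
  constructor
  · rintro ⟨hzero, hle⟩
    refine ⟨⟨fun h => ?_, fun i h hi => ?_⟩, ?_⟩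
    · have := hzero hpos'
      rwa [List.getElem_append_left h] at this
    · have := hle i (by rw [List.length_append]; omega) hi
      rwa [List.getElem_append_left h, List.take_append_of_le_length h.le] at this
    · have := hle l.length (by simp) hpos
      simpa using this
  · rintro ⟨⟨hzero, hle⟩, hx⟩
    refine ⟨fun h => ?_, fun i h hi => ?_⟩
    · rw [List.getElem_append_left hpos]
      exact hzero hpos
    · rcases Nat.lt_or_ge i l.length with hil | hil
      · rw [List.getElem_append_left hil, List.take_append_of_le_length hil.le]
        exact hle i hil hi
      · obtain rfl : i = l.length := by rw [List.length_append, List.length_singleton] at h; omega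
        simpa using hx

/-- The Fishburn matrix of an ascent sequence. -/
noncomputable def toMatrix (l : List ℕ) : Multiset (ℕ × ℕ) :=
  l.reverseRecOn 0 fun l x M => addEntry (ascBound l) M x

theorem toMatrix_nil : toMatrix [] = 0 := by
  rw [toMatrix, List.reverseRecOn_nil]

theorem toMatrix_concat (l : List ℕ) (x : ℕ) :
    toMatrix (l ++ [x]) = addEntry (ascBound l) (toMatrix l) x := by
  rw [toMatrix, List.reverseRecOn_concat, toMatrix]

theorem card_toMatrix (l : List ℕ) : (toMatrix l).card = l.length := by
  induction l using List.reverseRecOn with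
  | nil => rw [toMatrix_nil, Multiset.card_zero, List.length_nil]
  | append_singleton l x ih => rw [toMatrix_concat, card_addEntry, ih, List.length_append,
    List.length_singleton]

theorem isFishburn_and_isIndexed_toMatrix (hl : IsAscentSeq l) :
    IsFishburn (ascBound l) (toMatrix l) ∧
      (l ≠ [] → IsIndexed (ascBound l) (l.getLastD 0) (toMatrix l)) := by
  induction l using List.reverseRecOn with
  | nil => exact ⟨by rw [toMatrix_nil]; exact isFishburn_zero, fun h => absurd rfl h⟩
  | append_singleton l x ih =>
    rw [isAscentSeq_concat] at hl
    obtain ⟨hfish, hidx⟩ := ih hl.1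
    have hrow : NeedsNewRow (ascBound l) (toMatrix l) x ↔ l = [] ∨ l.getLastD 0 < x := by
      rcases eq_or_ne l [] with rfl | hne
      · exact iff_of_true (Or.inl rfl) (Or.inl rfl)
      · rw [(hidx hne).needsNewRow_iff, or_iff_right hne]
    have hadd := hfish.isIndexed_addEntry hl.2
    simp only [hrow, ← ascBound_concat, ← toMatrix_concat] at hadd
    rw [List.getLastD_concat]
    exact ⟨hadd.toIsFishburn, fun _ => hadd⟩

theorem isFishburn_toMatrix (hl : IsAscentSeq l) : IsFishburn (ascBound l) (toMatrix l) :=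
  (isFishburn_and_isIndexed_toMatrix hl).1

theorem countP_toMatrix (hl : IsAscentSeq l) :
    ((toMatrix l).countP fun q => q.1 = 0) = l.count 0 := by
  induction l using List.reverseRecOn with
  | nil => rw [toMatrix_nil, Multiset.countP_zero, List.count_nil]
  | append_singleton l x ih =>
    rw [isAscentSeq_concat] at hl
    rw [toMatrix_concat, (isFishburn_toMatrix hl.1).countP_addEntry, ih hl.1, List.count_append,
      List.count_singleton]
    simp only [beq_iff_eq]

theorem toMatrix_injOn : Set.InjOn toMatrix {l | IsAscentSeq l} := by
  intro l hl
  induction l using List.reverseRecOn with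
  | nil =>
    intro l' _ heq
    have := congrArg Multiset.card heq
    rw [card_toMatrix, card_toMatrix] at this
    exact (List.length_eq_zero_iff.1 this.symm).symm
  | append_singleton l x ih =>
    intro l' hl' heq
    rcases l'.eq_nil_or_concat' with rfl | ⟨l', x', rfl⟩
    · have := congrArg Multiset.card heq
      simp [card_toMatrix] at this
    rw [Set.mem_ofPred_eq, isAscentSeq_concat] at hl hl'
    rw [toMatrix_concat, toMatrix_concat] at heq
    obtain ⟨hmat, rfl⟩ := (isFishburn_toMatrix hl.1).addEntry_injective
      (isFishburn_toMatrix hl'.1) hl.2 hl'.2 heq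
    rw [ih hl.1 hl'.1 hmat]

theorem IsFishburn.exists_toMatrix_eq {d : ℕ} {M : Multiset (ℕ × ℕ)} (h : IsFishburn d M) :
    ∃ l, IsAscentSeq l ∧ toMatrix l = M := by
  induction hn : M.card generalizing M d with
  | zero => exact ⟨[], isAscentSeq_nil, by rw [toMatrix_nil, Multiset.card_eq_zero.1 hn]⟩
  | succ n ih =>
    obtain ⟨⟨a, b⟩, hab⟩ := Multiset.card_pos_iff_exists_mem.1 (n.succ_pos.trans_eq hn.symm)
    obtain ⟨x, hx⟩ := h.exists_isIndexed (Nat.zero_lt_of_lt (h.upper a b hab).2)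
    obtain ⟨e, N, hN, hxe, rfl⟩ := hx.exists_addEntry_eq
    rw [card_addEntry, Nat.add_right_cancel_iff] at hn
    obtain ⟨l, hl, rfl⟩ := ih hN hn
    obtain rfl := hN.dim_unique (isFishburn_toMatrix hl)
    exact ⟨l ++ [x], isAscentSeq_concat.2 ⟨hl, hxe⟩, toMatrix_concat l x⟩

theorem toMatrix_bijOn (n : ℕ) : Set.BijOn toMatrix (ascentSeqs n) (fishburnMatrices n) := by
  refine ⟨fun l ⟨hl, hn⟩ => ⟨(card_toMatrix l).trans hn, _, isFishburn_toMatrix hl⟩,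
    toMatrix_injOn.mono fun l hl => hl.1, ?_⟩
  rintro M ⟨hM, d, hd⟩
  obtain ⟨l, hl, rfl⟩ := hd.exists_toMatrix_eq
  exact ⟨l, ⟨hl, (card_toMatrix l).symm.trans hM⟩, rfl⟩

theorem toMatrix_bijOn_zeros (n k : ℕ) : Set.BijOn toMatrix (ascentSeqsZeros n k)
    {M ∈ fishburnMatrices n | (M.countP fun q => q.1 = 0) = k} := by
  refine ⟨fun l ⟨hl, hn, hk⟩ => ⟨(toMatrix_bijOn n).mapsTo ⟨hl, hn⟩,
    (countP_toMatrix hl).trans hk⟩, toMatrix_injOn.mono fun l hl => hl.1, ?_⟩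
  rintro M ⟨hM, hk⟩
  obtain ⟨l, ⟨hl, hn⟩, rfl⟩ := (toMatrix_bijOn n).surjOn hM
  exact ⟨l, ⟨hl, hn, (countP_toMatrix hl).symm.trans hk⟩, rfl⟩

theorem p_eq_ncard_ascentSeqs (n : ℕ) : p n = (ascentSeqs n).ncard := by
  rw [p_eq_ncard_fishburnMatrices, (toMatrix_bijOn n).ncard_eq]

theorem pMin_eq_ncard_ascentSeqsZeros (n k : ℕ) : pMin n k = (ascentSeqsZeros n k).ncard := by
  rw [pMin_eq_ncard_fishburnMatrices, (toMatrix_bijOn_zeros n k).ncard_eq]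

theorem zeroShift_concat (l : List ℕ) (x : ℕ) : zeroShift (l ++ [x]) = zeroShift l ++ [x + 1] := by
  simp [zeroShift]

theorem ascBound_zeroShift (l : List ℕ) : ascBound (zeroShift l) = ascBound l + 1 := by
  induction l using List.reverseRecOn with
  | nil => rfl
  | append_singleton l x ih =>
    have hlast : l = [] ∨ l.getLastD 0 < x ↔
        zeroShift l = [] ∨ (zeroShift l).getLastD 0 < x + 1 := by
      rcases l.eq_nil_or_concat' with rfl | ⟨m, y, rfl⟩
      · simp [zeroShift]
      · simp [zeroShift_concat]
    rw [zeroShift_concat, ascBound_concat, ascBound_concat, ih, if_congr hlast rfl rfl,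
      apply_ite (· + 1)]

theorem isAscentSeq_zeroShift_iff : IsAscentSeq (zeroShift l) ↔ IsAscentSeq l := by
  induction l using List.reverseRecOn with
  | nil => exact iff_of_true (isAscentSeq_concat.2 ⟨isAscentSeq_nil, le_rfl⟩) isAscentSeq_nil
  | append_singleton l x ih =>
    rw [zeroShift_concat, isAscentSeq_concat, isAscentSeq_concat, ih, ascBound_zeroShift,
      Nat.add_le_add_iff_right]

theorem exists_zeroShift_eq (h : 0 ∉ l) : ∃ m, zeroShift m = 0 :: l := by
  refine ⟨l.map (· - 1), congrArg (List.cons 0) ?_⟩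
  rw [List.map_map]
  refine (List.map_congr_left fun y hy => ?_).trans l.map_id
  exact Nat.sub_add_cancel (Nat.pos_of_ne_zero fun hy₀ => h (hy₀ ▸ hy))

theorem zeroShift_bijOn (n : ℕ) :
    Set.BijOn zeroShift (ascentSeqs n) (ascentSeqsZeros (n + 1) 1) := by
  refine ⟨?_, ?_, ?_⟩
  · rintro l ⟨hl, hn⟩
    refine ⟨isAscentSeq_zeroShift_iff.2 hl, by simp [zeroShift, hn], ?_⟩
    rw [zeroShift, List.count_cons_self, List.count_eq_zero_of_not_mem (by simp)]
  · intro l _ l' _ h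
    exact List.map_injective_iff.2 (add_left_injective 1) (List.cons.inj h).2
  · rintro (_ | ⟨x, l⟩) ⟨hl, hn, hk⟩
    · simp at hn
    · obtain rfl : x = 0 := hl.1 (by simp)
      rw [List.count_cons_self, Nat.add_eq_right, List.count_eq_zero] at hk
      obtain ⟨m, hm⟩ := exists_zeroShift_eq hk
      rw [← hm] at hl hn
      refine ⟨m, ⟨isAscentSeq_zeroShift_iff.1 hl, ?_⟩, hm⟩
      simpa [zeroShift] using hn

theorem pMin_succ_one (n : ℕ) : pMin (n + 1) 1 = p n := by
  rw [pMin_eq_ncard_ascentSeqsZeros, p_eq_ncard_ascentSeqs, (zeroShift_bijOn n).ncard_eq]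

theorem pMin_zero_one : pMin 0 1 = 0 := by
  have hempty : ascentSeqsZeros 0 1 = ∅ := by
    rw [Set.eq_empty_iff_forall_notMem]
    rintro l ⟨-, hn, hk⟩
    have := l.count_le_length (a := 0)
    omega
  rw [pMin_eq_ncard_ascentSeqsZeros, hempty, Set.ncard_empty]

open PowerSeries in
theorem X_mul_genP : X * genP = constantCoeff (derivative ℤ⟦X⟧ genPz) := by
  rw [← coeff_zero_eq_constantCoeff_apply, coeff_derivative, genPz, coeff_mk, zero_add,
    Nat.cast_zero, zero_add, mul_one]
  ext n
  cases n with
  | zero => rw [coeff_zero_X_mul, coeff_mk, pMin_zero_one, Nat.cast_zero]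
  | succ n => rw [coeff_succ_X_mul, coeff_mk, pMin_succ_one, genP, coeff_mk]

end AscentSequences

section MultisetGen

open PowerSeries

variable {α β : Type*} [DecidableEq α] {s : Finset α} {n : ℕ}

/-- The multisets of size `n` with elements in `s`. -/
def multisetsOn (s : Finset α) (n : ℕ) : Finset (Multiset α) :=
  (s.sym n).map ⟨Sym.toMultiset, Sym.coe_injective⟩

theorem mem_multisetsOn {M : Multiset α} :
    M ∈ multisetsOn s n ↔ M.card = n ∧ ∀ x ∈ M, x ∈ s := by
  simp only [multisetsOn, Finset.mem_map, Finset.mem_sym_iff, Function.Embedding.coeFn_mk]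
  constructor
  · rintro ⟨m, hm, rfl⟩
    exact ⟨m.2, hm⟩
  · rintro ⟨hM, hs⟩
    exact ⟨⟨M, hM⟩, hs, rfl⟩

theorem card_multisetsOn (s : Finset α) (n : ℕ) :
    (multisetsOn s n).card = s.card.multichoose n := by
  rw [multisetsOn, Finset.card_map]
  conv_lhs => rw [← s.attach_map_val, Finset.sym_map, Finset.card_map, Finset.attach_eq_univ,
    Finset.sym_univ, Finset.card_univ, Sym.card_sym_eq_multichoose, Fintype.card_coe]

open Classical in
/-- The generating function, by size, of the multisets with elements in `s` that satisfy `P`. -/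
noncomputable def multisetGen (s : Finset α) (P : Multiset α → Prop) : ℤ⟦X⟧ :=
  mk fun n => ((multisetsOn s n).filter P).card

open Classical in
theorem coeff_multisetGen (s : Finset α) (P : Multiset α → Prop) (n : ℕ) :
    coeff n (multisetGen s P) = ∑ M ∈ multisetsOn s n, if P M then 1 else 0 := by
  rw [multisetGen, coeff_mk, Finset.sum_boole]

theorem multisetGen_congr {P Q : Multiset α → Prop}
    (h : ∀ M : Multiset α, (∀ x ∈ M, x ∈ s) → (P M ↔ Q M)) :
    multisetGen s P = multisetGen s Q := by
  classical
  ext n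
  rw [coeff_multisetGen, coeff_multisetGen]
  exact Finset.sum_congr rfl fun M hM => if_congr (h M (mem_multisetsOn.1 hM).2) rfl rfl

theorem mk_multichoose (a : ℕ) : (mk fun n => (a.multichoose n : ℤ)) = mk 1 ^ a := by
  cases a with
  | zero =>
    ext n
    rw [pow_zero, coeff_mk, coeff_one]
    cases n <;> simp
  | succ a =>
    rw [mk_one_pow_eq_mk_choose_add]
    ext n
    rw [coeff_mk, coeff_mk, Nat.multichoose_eq, Nat.succ_add_sub_one, Nat.choose_symm_add]

theorem multisetGen_true (s : Finset α) : multisetGen s (fun _ => True) = mk 1 ^ s.card := by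
  rw [← mk_multichoose]
  ext n
  rw [multisetGen, coeff_mk, coeff_mk, Finset.filter_true, card_multisetsOn]

theorem multisetGen_and_forall_mem (s : Finset α) (P : Multiset α → Prop) (q : α → Prop)
    [DecidablePred q] :
    multisetGen s (fun M => P M ∧ ∀ x ∈ M, q x) = multisetGen (s.filter q) P := by
  classical
  ext n
  rw [multisetGen, multisetGen, coeff_mk, coeff_mk]
  congr 2
  ext M
  simp only [Finset.mem_filter, mem_multisetsOn]
  grind

open Classical in
theorem ite_forall_exists_eq_sum_powerset {α β : Type*} [DecidableEq β] {U : Finset β} {c : α → β}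
    {M : Multiset α} (hc : ∀ x ∈ M, c x ∈ U) :
    (if ∀ k ∈ U, ∃ x ∈ M, c x = k then (1 : ℤ) else 0) =
      ∑ R ∈ U.powerset, (-1) ^ (U \ R).card * if ∀ x ∈ M, c x ∈ R then 1 else 0 :=
  calc (if ∀ k ∈ U, ∃ x ∈ M, c x = k then (1 : ℤ) else 0)
      = ∏ k ∈ U, (1 + -if ∀ x ∈ M, c x ≠ k then 1 else 0) := by
        rw [← Finset.prod_boole]
        refine Finset.prod_congr rfl fun k _ => ?_
        by_cases hk : ∃ x ∈ M, c x = k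
        · simp [hk]
        · rw [if_neg hk, if_pos fun x hx hxk => hk ⟨x, hx, hxk⟩, add_neg_cancel]
    _ = ∑ R ∈ U.powerset, (-1) ^ (U \ R).card * if ∀ x ∈ M, c x ∈ R then 1 else 0 := by
        rw [Finset.prod_add]
        refine Finset.sum_congr rfl fun R _ => ?_
        rw [Finset.prod_const_one, one_mul, Finset.prod_neg, Finset.prod_boole]
        refine congrArg _ (if_congr ?_ rfl rfl)
        grind

theorem multisetGen_and_forall_exists [DecidableEq β] (P : Multiset α → Prop) {U : Finset β}
    {c : α → β} (hc : ∀ x ∈ s, c x ∈ U) :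
    multisetGen s (fun M => P M ∧ ∀ k ∈ U, ∃ x ∈ M, c x = k) =
      ∑ R ∈ U.powerset, (-1) ^ (U \ R).card * multisetGen {x ∈ s | c x ∈ R} P := by
  ext n
  have hsign : ∀ R : Finset β, (-1 : ℤ⟦X⟧) ^ (U \ R).card = C ((-1) ^ (U \ R).card) := by simp
  simp only [map_sum, hsign, coeff_C_mul, ← multisetGen_and_forall_mem, coeff_multisetGen,
    Finset.mul_sum]
  rw [Finset.sum_comm]
  refine Finset.sum_congr rfl fun M hM => ?_
  by_cases hP : P M
  · simp only [hP, true_and]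
    convert! ite_forall_exists_eq_sum_powerset fun x hx => hc x ((mem_multisetsOn.1 hM).2 x hx)
    exact and_iff_right hP
  · simp [hP]

/-- The generating function of the nonempty multisets with elements in a set of size `a`. -/
noncomputable def nonemptyMultisetGen (a : ℕ) : ℤ⟦X⟧ :=
  mk 1 ^ a - 1

theorem multisetGen_forall_exists [DecidableEq β] {U : Finset β} {c : α → β}
    (hc : ∀ x ∈ s, c x ∈ U) : multisetGen s (fun M => ∀ k ∈ U, ∃ x ∈ M, c x = k) =
      ∏ k ∈ U, nonemptyMultisetGen {x ∈ s | c x = k}.card := by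
  have h := multisetGen_and_forall_exists (fun _ => True) hc
  simp only [true_and] at h
  simp only [nonemptyMultisetGen, sub_eq_add_neg, Finset.prod_add, h]
  refine Finset.sum_congr rfl fun R _ => ?_
  rw [Finset.prod_const, mul_comm, multisetGen_true, Finset.prod_pow_eq_pow_sum,
    Finset.card_eq_sum_card_fiberwise (s := {x ∈ s | c x ∈ R})
      fun x hx => (Finset.mem_filter.1 hx).2]
  congr 2
  refine Finset.sum_congr rfl fun k hk => ?_
  rw [Finset.filter_filter]
  exact congrArg Finset.card (Finset.filter_congr fun x _ => and_iff_right_of_imp fun h => h ▸ hk)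

theorem nonemptyMultisetGen_zero : nonemptyMultisetGen 0 = 0 := by
  rw [nonemptyMultisetGen, pow_zero, sub_self]

theorem X_dvd_nonemptyMultisetGen (a : ℕ) : X ∣ nonemptyMultisetGen a := by
  rw [X_dvd_iff, nonemptyMultisetGen, map_sub, map_pow, ← coeff_zero_eq_constantCoeff_apply]
  simp

theorem nonemptyMultisetGen_mul_one_sub_X_pow (a : ℕ) :
    nonemptyMultisetGen a * (1 - X) ^ a = 1 - (1 - X) ^ a := by
  rw [nonemptyMultisetGen, sub_mul, one_mul, ← mul_pow, mk_one_mul_one_sub_eq_one, one_pow]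

end MultisetGen

section FishburnGen

open PowerSeries

variable {d n : ℕ} {R : Finset ℕ}

/-- The positions of the upper triangular matrices of dimension `d`. -/
def upperTriangle (d : ℕ) : Finset (ℕ × ℕ) :=
  {q ∈ Finset.range d ×ˢ Finset.range d | q.1 ≤ q.2}

theorem mem_upperTriangle {q : ℕ × ℕ} : q ∈ upperTriangle d ↔ q.1 ≤ q.2 ∧ q.2 < d := by
  simp only [upperTriangle, Finset.mem_filter, Finset.mem_product, Finset.mem_range]
  omega

theorem isFishburn_iff {M : Multiset (ℕ × ℕ)} : IsFishburn d M ↔ (∀ q ∈ M, q ∈ upperTriangle d) ∧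
    (∀ b ∈ Finset.range d, ∃ q ∈ M, q.2 = b) ∧ ∀ a ∈ Finset.range d, ∃ q ∈ M, q.1 = a := by
  simp only [mem_upperTriangle, Finset.mem_range, Prod.forall, Prod.exists, exists_and_right,
    exists_eq_right]
  exact ⟨fun h => ⟨h.upper, by simpa using h.col, by simpa using h.row⟩,
    fun h => ⟨h.1, by simpa using h.2.2, by simpa using h.2.1⟩⟩

/-- The generating function of the matrices of dimension `d` whose nonzero rows belong to `R` and
whose columns are nonzero. -/
noncomputable def fullColumnsGen (d : ℕ) (R : Finset ℕ) : ℤ⟦X⟧ :=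
  ∏ b ∈ Finset.range d, nonemptyMultisetGen {a ∈ R | a ≤ b}.card

theorem multisetGen_filter_upperTriangle (d : ℕ) (R : Finset ℕ) :
    multisetGen {q ∈ upperTriangle d | q.1 ∈ R}
      (fun M => ∀ b ∈ Finset.range d, ∃ q ∈ M, q.2 = b) = fullColumnsGen d R := by
  rw [multisetGen_forall_exists, fullColumnsGen]
  · refine Finset.prod_congr rfl fun b hb => congrArg _ ?_
    refine Finset.card_bij' (fun q _ => q.1) (fun a _ => (a, b)) ?_ ?_ ?_ ?_ <;>
      grind [mem_upperTriangle]
  · grind [mem_upperTriangle]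

theorem multisetGen_isFishburn (d : ℕ) : multisetGen (upperTriangle d) (IsFishburn d) =
    ∑ R ∈ (Finset.range d).powerset, (-1) ^ (Finset.range d \ R).card * fullColumnsGen d R :=
  calc multisetGen (upperTriangle d) (IsFishburn d)
      = multisetGen (upperTriangle d) fun M => (∀ b ∈ Finset.range d, ∃ q ∈ M, q.2 = b) ∧
          ∀ a ∈ Finset.range d, ∃ q ∈ M, q.1 = a := by
        refine multisetGen_congr fun M hM => ?_
        rw [isFishburn_iff, and_iff_right hM]
    _ = _ := by
        rw [multisetGen_and_forall_exists _ (by grind [mem_upperTriangle])]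
        simp only [multisetGen_filter_upperTriangle]

theorem ncard_fishburnMatrices (n : ℕ) : ((fishburnMatrices n).ncard : ℤ) =
    ∑ d ∈ Finset.range (n + 1), coeff n (multisetGen (upperTriangle d) (IsFishburn d)) := by
  classical
  let S : ℕ → Finset (Multiset (ℕ × ℕ)) := fun d =>
    (multisetsOn (upperTriangle d) n).filter (IsFishburn d)
  have mem_S : ∀ d M, M ∈ S d ↔ M.card = n ∧ IsFishburn d M := fun d M => by
    rw [Finset.mem_filter, mem_multisetsOn, and_assoc]
    exact and_congr_right fun _ => and_iff_right_of_imp fun h => (isFishburn_iff.1 h).1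
  have hunion : fishburnMatrices n = (Finset.range (n + 1)).biUnion S := by
    ext M
    simp only [Finset.coe_biUnion, Set.mem_iUnion, Finset.mem_coe, mem_S, Finset.mem_range]
    constructor
    · rintro ⟨hM, d, hd⟩
      exact ⟨d, Nat.lt_succ_of_le (hd.dim_le_card.trans_eq hM), hM, hd⟩
    · rintro ⟨d, -, hM, hd⟩
      exact ⟨hM, d, hd⟩
  have hdisj : (Finset.range (n + 1) : Set ℕ).PairwiseDisjoint S := fun d _ e _ hde =>
    Finset.disjoint_left.2 fun M hd he => hde (((mem_S d M).1 hd).2.dim_unique ((mem_S e M).1 he).2)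
  rw [hunion, Set.ncard_coe_finset, Finset.card_biUnion hdisj, Nat.cast_sum]
  refine Finset.sum_congr rfl fun d _ => ?_
  rw [multisetGen, coeff_mk]

theorem fullColumnsGen_succ (hR : R ⊆ Finset.range (d + 1)) :
    fullColumnsGen (d + 1) R = nonemptyMultisetGen R.card * fullColumnsGen d R := by
  rw [fullColumnsGen, Finset.prod_range_succ_comm, fullColumnsGen,
    Finset.filter_true_of_mem fun a ha => Finset.mem_range_succ_iff.1 (hR ha)]

theorem fullColumnsGen_insert (d : ℕ) (R : Finset ℕ) :
    fullColumnsGen d (insert d R) = fullColumnsGen d R := by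
  refine Finset.prod_congr rfl fun b hb => ?_
  rw [Finset.filter_insert, if_neg (by grind)]

/-- The contribution of the sets of `a` rows to the inclusion-exclusion formula for the Fishburn
matrices of dimension `d`. -/
noncomputable def signedGen (d a : ℕ) : ℤ⟦X⟧ :=
  ∑ R ∈ Finset.powersetCard a (Finset.range d), (-1) ^ (d + a) * fullColumnsGen d R

theorem multisetGen_isFishburn_eq_sum_signedGen (h : d ≤ n) :
    multisetGen (upperTriangle d) (IsFishburn d) = ∑ a ∈ Finset.range (n + 1), signedGen d a := by
  have hzero : ∀ a ∈ Finset.range (n + 1), a ∉ Finset.range (d + 1) → signedGen d a = 0 := by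
    intro a _ ha
    rw [signedGen, Finset.powersetCard_eq_empty.2 (by simpa using ha), Finset.sum_empty]
  rw [← Finset.sum_subset (Finset.range_mono (by omega)) hzero, multisetGen_isFishburn,
    Finset.sum_powerset, Finset.card_range]
  refine Finset.sum_congr rfl fun a _ => Finset.sum_congr rfl fun R hR => ?_
  obtain ⟨hsub, rfl⟩ := Finset.mem_powersetCard.1 hR
  have hle := Finset.card_le_card hsub
  rw [Finset.card_sdiff_of_subset hsub, neg_one_pow_congr]
  grind

theorem signedGen_zero (a : ℕ) : signedGen 0 a = if a = 0 then 1 else 0 := by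
  cases a <;> simp [signedGen, fullColumnsGen]

theorem signedGen_succ_zero (d : ℕ) : signedGen (d + 1) 0 = 0 := by
  simp [signedGen, fullColumnsGen_succ, nonemptyMultisetGen_zero]

theorem signedGen_succ_succ (d a : ℕ) : signedGen (d + 1) (a + 1) =
    nonemptyMultisetGen (a + 1) * (signedGen d a - signedGen d (a + 1)) := by
  have hsum : signedGen (d + 1) (a + 1) = nonemptyMultisetGen (a + 1) *
      ∑ R ∈ Finset.powersetCard (a + 1) (Finset.range (d + 1)),
        (-1) ^ (d + a) * fullColumnsGen d R := by
    rw [signedGen, Finset.mul_sum]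
    refine Finset.sum_congr rfl fun R hR => ?_
    obtain ⟨hsub, hcard⟩ := Finset.mem_powersetCard.1 hR
    rw [fullColumnsGen_succ hsub, hcard]
    ring
  have hdisj : Disjoint (Finset.powersetCard (a + 1) (Finset.range d))
      ((Finset.powersetCard a (Finset.range d)).image (insert d)) := by
    grind [Finset.disjoint_left]
  have hinj : Set.InjOn (insert d) (Finset.powersetCard a (Finset.range d) : Set (Finset ℕ)) :=
    fun R hR S hS h => by
      have hd : ∀ T ∈ Finset.powersetCard a (Finset.range d), d ∉ T := by grind
      rw [← Finset.erase_insert (hd R hR), h, Finset.erase_insert (hd S hS)]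
  rw [hsum, Finset.range_add_one, Finset.powersetCard_succ_insert Finset.notMem_range_self,
    Finset.sum_union hdisj, Finset.sum_image hinj]
  simp only [fullColumnsGen_insert, signedGen, ← Finset.mul_sum]
  ring

/-- The summand `∏ᵢ (1 - (1 - t)^i)` of the generating function of the Fishburn numbers. -/
noncomputable def fishburnTerm (a : ℕ) : ℤ⟦X⟧ :=
  ∏ i ∈ Finset.Icc 1 a, (1 - (1 - X) ^ i)

theorem fishburnTerm_zero : fishburnTerm 0 = 1 := by
  rw [fishburnTerm, Finset.Icc_eq_empty (by omega), Finset.prod_empty]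

theorem fishburnTerm_succ (a : ℕ) :
    fishburnTerm (a + 1) = fishburnTerm a * (1 - (1 - X) ^ (a + 1)) := by
  rw [fishburnTerm, Finset.prod_Icc_succ_top (by omega), fishburnTerm]

theorem fishburnTerm_succ_eq_mul_sub (a : ℕ) : fishburnTerm (a + 1) =
    nonemptyMultisetGen (a + 1) * (fishburnTerm a - fishburnTerm (a + 1)) := by
  rw [fishburnTerm_succ]
  linear_combination -fishburnTerm a * nonemptyMultisetGen_mul_one_sub_X_pow (a + 1)

theorem X_pow_dvd_fishburnTerm (a : ℕ) : X ^ a ∣ fishburnTerm a := by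
  induction a with
  | zero => rw [pow_zero]; exact one_dvd _
  | succ a ih =>
    rw [fishburnTerm_succ, pow_succ, ← nonemptyMultisetGen_mul_one_sub_X_pow]
    exact mul_dvd_mul ih ((X_dvd_nonemptyMultisetGen _).mul_right _)

/-- Summed over `d`, the recursion `signedGen_succ_succ` becomes the recursion
`fishburnTerm_succ_eq_mul_sub`, whose factor `nonemptyMultisetGen (a + 1)` gains a power of `X`. -/
theorem X_pow_dvd_sum_signedGen_sub_fishburnTerm (D a : ℕ) :
    X ^ (D + 1) ∣ (∑ d ∈ Finset.range (D + 1), signedGen d a) - fishburnTerm a := by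
  induction D generalizing a with
  | zero =>
    rw [zero_add, Finset.sum_range_one, signedGen_zero, pow_one]
    split_ifs with ha
    · rw [ha, fishburnTerm_zero, sub_self]
      exact dvd_zero X
    · rw [zero_sub, dvd_neg]
      exact (dvd_pow_self X ha).trans (X_pow_dvd_fishburnTerm a)
  | succ D ih =>
    rw [Finset.sum_range_succ', signedGen_zero]
    cases a with
    | zero => simp [signedGen_succ_zero, fishburnTerm_zero]
    | succ a =>
      have hfactor : ∑ d ∈ Finset.range (D + 1), signedGen (d + 1) (a + 1) - fishburnTerm (a + 1) =
          (((∑ d ∈ Finset.range (D + 1), signedGen d a) - fishburnTerm a) -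
            ((∑ d ∈ Finset.range (D + 1), signedGen d (a + 1)) - fishburnTerm (a + 1))) *
              nonemptyMultisetGen (a + 1) := by
        simp only [signedGen_succ_succ, ← Finset.mul_sum, Finset.sum_sub_distrib]
        linear_combination -fishburnTerm_succ_eq_mul_sub a
      rw [if_neg a.succ_ne_zero, add_zero, hfactor, pow_succ]
      exact mul_dvd_mul ((ih a).sub (ih (a + 1))) (X_dvd_nonemptyMultisetGen _)

theorem p_eq_sum_coeff_fishburnTerm (n : ℕ) :
    (p n : ℤ) = ∑ a ∈ Finset.range (n + 1), coeff n (fishburnTerm a) := by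
  have hsigned : ∀ d ∈ Finset.range (n + 1),
      coeff n (multisetGen (upperTriangle d) (IsFishburn d)) =
        ∑ a ∈ Finset.range (n + 1), coeff n (signedGen d a) := fun d hd => by
    rw [multisetGen_isFishburn_eq_sum_signedGen (Finset.mem_range_succ_iff.1 hd), map_sum]
  rw [p_eq_ncard_fishburnMatrices, ncard_fishburnMatrices, Finset.sum_congr rfl hsigned,
    Finset.sum_comm]
  refine Finset.sum_congr rfl fun a _ => ?_
  have h := X_pow_dvd_iff.1 (X_pow_dvd_sum_signedGen_sub_fishburnTerm n a) n n.lt_succ_self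
  rwa [map_sub, sub_eq_zero, map_sum] at h

theorem hasSum_fishburnTerm : HasSum fishburnTerm genP := by
  rw [PowerSeries.WithPiTopology.hasSum_iff_hasSum_coeff]
  intro n
  rw [genP, coeff_mk, p_eq_sum_coeff_fishburnTerm]
  refine hasSum_sum_of_ne_finset_zero fun a ha => ?_
  exact X_pow_dvd_iff.1 (X_pow_dvd_fishburnTerm a) n (by simpa using ha)

end FishburnGen

end TwoPlusTwo

theorem mainTheorem3 :
    -- the number of (2+2)-free posets of size `n` (with `k` minimal elements) is the number of
    -- ascent sequences of length `n` (with `k` zeros)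
    (∀ n : ℕ, TwoPlusTwo.p n = (TwoPlusTwo.ascentSeqs n).ncard) ∧
    (∀ n k : ℕ, TwoPlusTwo.pMin n k = (TwoPlusTwo.ascentSeqsZeros n k).ncard) ∧
    -- the bijection between ascent sequences of length `n` and those of length `n + 1`
    -- with exactly one zero
    (∀ n : ℕ, Set.BijOn TwoPlusTwo.zeroShift
      (TwoPlusTwo.ascentSeqs n) (TwoPlusTwo.ascentSeqsZeros (n + 1) 1)) ∧
    -- `t P(t) = ∂_z P(t, z)` at `z = 0`
    (PowerSeries.X * TwoPlusTwo.genP =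
      PowerSeries.constantCoeff
        (PowerSeries.derivative (PowerSeries ℤ) TwoPlusTwo.genPz)) ∧
    -- `P(t) = ∑ₙ ∏ᵢ (1 - (1 - t)^i)`, a convergent sum of formal power series
    HasSum (fun n : ℕ => ∏ i ∈ Finset.Icc 1 n, (1 - (1 - (PowerSeries.X : PowerSeries ℤ)) ^ i))
      TwoPlusTwo.genP :=
  ⟨TwoPlusTwo.p_eq_ncard_ascentSeqs, TwoPlusTwo.pMin_eq_ncard_ascentSeqsZeros,
    TwoPlusTwo.zeroShift_bijOn, TwoPlusTwo.X_mul_genP, TwoPlusTwo.hasSum_fishburnTerm⟩
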